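/- Let $p$ and $q$ be distinct primes, and let $K/\mathbb{Q}_p$ be a finite unramified extension with ring of integers $\mathcal{O}_K$. Let $v$ be the $p$-adic valuation on $K$, normalized so that $v(p)=1$. Let $f\in\mathcal{O}_K[x]$ be a polynomial of degree $q$ that is irreducible in the ring $\mathcal{O}_K[x]$ (not necessarily monic), let $\Delta_f\in\mathcal{O}_K$ be its discriminant, and let $\theta$ be a root of $f$ in an extension field of $K$. Then $K(\theta)/K$ is unramified if and only if $q(q-1)$ divides the integer $v(\Delta_f)$. -/

import Mathlib

open Polynomial
open scoped IntermediateField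

/-- For a domain `A` (here: the ring of integers of a local field `F`) and a field extension `L`
of `F`, the extension `L / F` is unramified when the ring of integers of `L`, i.e. the integral
closure of `A` in `L`, is an unramified `A`-algebra. -/
def IsUnramifiedExtension (A L : Type*) [CommRing A] [Field L] [Algebra A L] : Prop :=
  Algebra.Unramified A (integralClosure A L)

/-- The `p`-adic valuation on an algebraic extension `K` of `ℚ_[p]`, normalized by `v p = 1`:
`v x = - log_p |x|`, where `|x|` is the unique extension to `K` of the `p`-adic absolute value.
(The value at `x = 0` is the junk value `0`.) -/
noncomputable def extPadicVal (p : ℕ) [Fact p.Prime] (K : Type*) [Field K] [Algebra ℚ_[p] K]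
    (x : K) : ℝ :=
  -Real.logb p (spectralNorm ℚ_[p] K x)

/-! Write `n = q`, `M = max 1 ‖θ‖`, and let `α = θ - tr(θ)/n` be the trace-zero part of `θ`; since
`q ≠ p`, `n` has norm 1. The crux is that `‖g'(θ)‖ = ‖α‖^(n-1)` for the minimal polynomial `g` of
`θ`, ramified or not (`norm_aeval_derivative_minpoly_of_finrank_prime`). If `‖α‖` is not a norm from
`K`, the leading term of the derivative dominates. If it is, scale `α` to norm 1: trace zero keeps
its residue out of the residue field of `K`, so, the degree being prime, the extension is unramified
and the scaled derivative is a unit.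

Primitivity of `f` gives `‖lc f‖ * M^n = 1`, hence `‖Δ‖ = (‖α‖/M^2)^(n(n-1))`
(`norm_discr_of_finrank_prime`). So the divisibility says exactly that `‖α‖/M^2` is a norm from `K`,
whose value group is generated by `‖p‖` because `K` is unramified over `ℚ_[p]`. By
`formallyUnramified_iff_exists_zpow` this is equivalent to `K(θ)/K` being unramified. -/

/-! ### Residue degree and unramifiedness for finite local extensions. -/

namespace IsLocalRing

variable {R S : Type*} [CommRing R] [CommRing S] [Algebra R S] [IsLocalRing R] [IsLocalRing S]
  [Module.Finite R S]

/-- The quotient of `S` by the extended maximal ideal has dimension `finrank R S` and surjects onto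
the residue field; equal dimensions make the surjection injective. -/
theorem map_maximalIdeal_of_finrank_residueField_eq [Module.Free R S]
    (h : Module.finrank (ResidueField R) (ResidueField S) = Module.finrank R S) :
    (maximalIdeal R).map (algebraMap R S) = maximalIdeal S := by
  have hle : (maximalIdeal R).map (algebraMap R S) ≤ maximalIdeal S :=
    ((local_hom_TFAE (algebraMap R S)).out 0 2 rfl rfl).mp inferInstance
  let : Module (ResidueField R) (S ⧸ (maximalIdeal R).map (algebraMap R S)) :=
    inferInstanceAs (Module (R ⧸ maximalIdeal R) _)
  have : Module.Finite (R ⧸ maximalIdeal R) (S ⧸ (maximalIdeal R).map (algebraMap R S)) :=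
    Module.Finite.of_restrictScalars_finite R _ _
  have : Module.Finite (ResidueField R) (S ⧸ (maximalIdeal R).map (algebraMap R S)) := this
  let φ : (S ⧸ (maximalIdeal R).map (algebraMap R S)) →ₗ[ResidueField R] ResidueField S :=
    { toFun := Ideal.Quotient.factor hle
      map_add' := map_add _
      map_smul' := by
        intro r x
        obtain ⟨r, rfl⟩ := residue_surjective r
        obtain ⟨x, rfl⟩ := Ideal.Quotient.mk_surjective x
        rfl }
  have hφ : Function.Surjective φ := Ideal.Quotient.factor_surjective hle
  have hinj : Function.Injective φ :=
    (LinearMap.injective_iff_surjective_of_finrank_eq_finrank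
      ((finrank_quotient_map (R := R) (S := S)).trans h.symm)).mpr hφ
  refine le_antisymm hle fun x hx ↦ ?_
  rw [← Ideal.Quotient.eq_zero_iff_mem]
  apply hinj
  rw [map_zero]
  exact Ideal.Quotient.eq_zero_iff_mem.mpr hx

variable [FaithfulSMul R S]

/-- The residue degree of a finite flat local extension divides its degree. -/
theorem finrank_residueField_dvd_finrank [IsDomain R] [Module.Flat R S] :
    Module.finrank (ResidueField R) (ResidueField S) ∣ Module.finrank R S := by
  have hover : ∀ P : (maximalIdeal R).primesOver S, P.1 = maximalIdeal S := by
    rintro ⟨P, hP, hP'⟩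
    exact eq_maximalIdeal (Ideal.isMaximal_of_isIntegral_of_isMaximal_comap (R := R) P
      (by rw [← Ideal.under_def, ← hP'.over]; infer_instance))
  have hlies : (maximalIdeal S).LiesOver (maximalIdeal R) :=
    ⟨((local_hom_TFAE (algebraMap R S)).out 0 4 rfl rfl).mp inferInstance |>.symm⟩
  let P₀ : (maximalIdeal R).primesOver S := ⟨maximalIdeal S, inferInstance, hlies⟩
  let : Unique ((maximalIdeal R).primesOver S) :=
    { default := P₀, uniq := fun P ↦ Subtype.ext (hover P) }
  rw [← Ideal.sum_ramification_inertia_eq_finrank (maximalIdeal R) S, Fintype.sum_unique]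
  change _ ∣ (maximalIdeal S).ramificationIdx R * (maximalIdeal S).inertiaDeg R
  rw [Ideal.inertiaDeg_eq_of_isMaximal (maximalIdeal R) (maximalIdeal S)]
  exact dvd_mul_left _ _

/-- In a finite free local extension of prime degree, a nontrivial residue extension forces
unramifiedness. -/
theorem formallyUnramified_of_residue_notMem_range [IsDomain R] [Module.Free R S]
    [PerfectField (ResidueField R)] (hS : (Module.finrank R S).Prime) {u : S}
    (hu : residue S u ∉ Set.range (algebraMap (ResidueField R) (ResidueField S))) :
    Algebra.FormallyUnramified R S := by
  have hf1 : Module.finrank (ResidueField R) (ResidueField S) ≠ 1 := by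
    intro h
    obtain ⟨c, hc⟩ := (finrank_eq_one_iff_of_nonzero' (1 : ResidueField S) one_ne_zero).mp h
      (residue S u)
    exact hu ⟨c, by rw [← hc, Algebra.algebraMap_eq_smul_one]⟩
  exact .of_map_maximalIdeal (map_maximalIdeal_of_finrank_residueField_eq
    (((Nat.dvd_prime hS).mp finrank_residueField_dvd_finrank).resolve_left hf1))

/-- A residue extension of prime degree has no proper intermediate algebras, so the residue of `u`
generates it. Hence `u` generates `S`, which is étale over `R`. -/
theorem isUnit_aeval_derivative_minpoly_of_residue_notMem_range [IsNoetherianRing R]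
    [Module.Flat R S] [Algebra.FormallyUnramified R S] (hS : (Module.finrank R S).Prime) {u : S}
    (hu : residue S u ∉ Set.range (algebraMap (ResidueField R) (ResidueField S))) :
    IsUnit (aeval u (minpoly R u).derivative) := by
  have : Algebra.FinitePresentation R S := Algebra.FinitePresentation.of_finiteType.mp inferInstance
  have : Algebra.Etale R S := .of_formallyUnramified_of_flat
  apply isUnit_aeval_derivative_minpoly_of_adjoin_eq_top
  rw [← adjoin_residue_eq_top_iff_adjoin_eq_top]
  rw [finrank_eq_finrank_residueField] at hS
  have := Subalgebra.isSimpleOrder_of_finrank_prime _ _ hS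
  refine (eq_bot_or_eq_top _).resolve_left fun h ↦ hu ?_
  rw [← Algebra.mem_bot, ← h]
  exact Algebra.subset_adjoin rfl

end IsLocalRing

/-! ### Norms of coefficients, traces and discriminants. -/

section Norm

variable {K L : Type*} [NontriviallyNormedField K] [IsUltrametricDist K] [CompleteSpace K]
  [NormedField L] [NormedAlgebra K L] [FiniteDimensional K L]

theorem norm_coeff_minpoly_le (x : L) {i : ℕ} (hi : i ≤ (minpoly K x).natDegree) :
    ‖(minpoly K x).coeff i‖ ≤ ‖x‖ ^ ((minpoly K x).natDegree - i) := by
  rcases hi.eq_or_lt with rfl | hi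
  · simp [(minpoly.monic (Algebra.IsIntegral.isIntegral (R := K) x)).coeff_natDegree]
  have h : spectralValueTerms (minpoly K x) i ≤ ‖x‖ := by
    rw [NormedAlgebra.norm_eq_spectralNorm K x]
    exact le_ciSup (spectralValueTerms_bddAbove _) i
  rw [spectralValueTerms_of_lt_natDegree _ hi] at h
  have hpos : (0 : ℝ) < ((minpoly K x).natDegree : ℝ) - i := by
    rw [sub_pos]; exact_mod_cast hi
  rw [one_div, Real.rpow_inv_le_iff_of_pos (norm_nonneg _) (norm_nonneg _) hpos,
    ← Nat.cast_sub hi.le, Real.rpow_natCast] at h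
  exact h

theorem norm_coeff_zero_minpoly (x : L) :
    ‖(minpoly K x).coeff 0‖ = ‖x‖ ^ (minpoly K x).natDegree := by
  have hd : (minpoly K x).natDegree ≠ 0 :=
    (minpoly.natDegree_pos (Algebra.IsIntegral.isIntegral x)).ne'
  rw [NormedAlgebra.norm_eq_spectralNorm K x, spectralNorm.spectralNorm_eq_norm_coeff_zero_rpow,
    one_div, Real.rpow_inv_natCast_pow (norm_nonneg _) hd]

theorem norm_trace_le (x : L) : ‖Algebra.trace K L x‖ ≤ ‖x‖ := by
  have hd := minpoly.natDegree_pos (Algebra.IsIntegral.isIntegral (R := K) x)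
  rw [trace_eq_finrank_mul_minpoly_nextCoeff, norm_mul, norm_neg,
    nextCoeff_of_natDegree_pos hd]
  have h := norm_coeff_minpoly_le (K := K) x (Nat.sub_le (minpoly K x).natDegree 1)
  rw [Nat.sub_sub_self hd, pow_one] at h
  exact (mul_le_of_le_one_left (norm_nonneg _) (IsUltrametricDist.norm_natCast_le_one K _)).trans h

/-- If the degree is a unit, an element of trace zero is no closer to `d : K` than `0` is. -/
theorem norm_le_norm_sub_of_trace_eq_zero (hn : ‖(Module.finrank K L : K)‖ = 1) {x : L}
    (hx : Algebra.trace K L x = 0) (d : K) : ‖d‖ ≤ ‖x - algebraMap K L d‖ := by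
  have h := norm_trace_le (K := K) (x - algebraMap K L d)
  rwa [map_sub, hx, zero_sub, norm_neg, Algebra.trace_algebraMap, nsmul_eq_mul, norm_mul, hn,
    one_mul] at h

/-- The norm of a discriminant in terms of the derivative of the minimal polynomial at a root. -/
theorem norm_discr_eq {F : K[X]} {x : L} (hF : F = C F.leadingCoeff * minpoly K x)
    (hF0 : F ≠ 0) :
    ‖F.discr‖ = ‖F.leadingCoeff‖ ^ (2 * (F.natDegree - 1)) *
      ‖aeval x (minpoly K x).derivative‖ ^ F.natDegree := by
  set n := F.natDegree with hn
  have hdeg : n = (minpoly K x).natDegree := by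
    rw [hn, hF, natDegree_C_mul (by simpa using hF0)]
  have hn0 : 0 < n := hdeg ▸ minpoly.natDegree_pos (Algebra.IsIntegral.isIntegral x)
  have hlc : ‖F.leadingCoeff‖ ≠ 0 := by simpa using hF0
  let E := AlgebraicClosure L
  let N := spectralMulAlgNorm K E
  have hNK : ∀ a : K, N (algebraMap K E a) = ‖a‖ := fun a ↦ spectralNorm_extends a
  have hNL : ∀ y : L, N (algebraMap L E y) = ‖y‖ := fun y ↦ by
    rw [NormedAlgebra.norm_eq_spectralNorm K y]
    exact (spectralNorm.eq_of_tower (K := K) (L := E) y).symm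
  have hsplit : (F.map (algebraMap K E)).Splits := IsAlgClosed.splits _
  -- The roots are conjugate to `x` and the spectral norm is invariant under automorphisms, so all
  -- factors of the resultant have the same norm.
  have hroots : ∀ r ∈ (F.map (algebraMap K E)).roots,
      N ((F.derivative.map (algebraMap K E)).eval r) = ‖aeval x F.derivative‖ := by
    intro r hr
    have hr' : aeval r (minpoly K (algebraMap L E x)) = 0 := by
      have := (mem_roots'.mp hr).2
      rw [IsRoot.def, eval_map_algebraMap, hF, map_mul, aeval_C, mul_eq_zero] at this
      rw [minpoly.algebraMap_eq (algebraMap L E).injective]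
      exact this.resolve_left (by simpa using hF0)
    obtain ⟨σ, hσ⟩ := minpoly.exists_algEquiv_of_root'
      (Algebra.IsAlgebraic.isAlgebraic (R := K) (algebraMap L E x)) hr'
    rw [eval_map_algebraMap, ← hσ, ← hNL, ← aeval_algebraMap_apply, ← AlgEquiv.coe_toAlgHom,
      aeval_algHom_apply]
    exact (spectralNorm_eq_of_equiv σ _).symm
  have hres := resultant_eq_prod_eval (F.map (algebraMap K E)) (F.derivative.map (algebraMap K E))
    (n - 1) ((natDegree_map_le).trans (natDegree_derivative_le F)) hsplit
  rw [natDegree_map, resultant_map_map, resultant_deriv (natDegree_pos_iff_degree_pos.mp hn0),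
    leadingCoeff_map] at hres
  have hN := congrArg N hres
  rw [hNK, map_mul, map_pow, hNK, map_multiset_prod, Multiset.map_map,
    Multiset.map_congr rfl (by simpa using hroots), Multiset.map_const', Multiset.prod_replicate,
    ← hsplit.natDegree_eq_card_roots, natDegree_map, norm_mul, norm_mul, norm_pow, norm_neg,
    norm_one, one_pow, one_mul, ← hn] at hN
  have hder : aeval x F.derivative =
      algebraMap K L F.leadingCoeff * aeval x (minpoly K x).derivative := by
    conv_lhs => rw [hF]
    simp
  rw [hder, norm_mul, norm_algebraMap', mul_pow] at hN
  -- The resultant of `F` and its derivative is the discriminant times the leading coefficient, up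
  -- to sign.
  apply mul_left_cancel₀ hlc
  rw [hN]
  obtain ⟨m, hm⟩ : ∃ m, n = m + 1 := ⟨n - 1, by omega⟩
  rw [hm, Nat.add_sub_cancel]
  ring

end Norm

/-! ### Rings of integers and value groups. -/

section Integers

open NormedField IsLocalRing

/-- The norms of a discretely valued field are the powers of the norm of a uniformizer. -/
theorem exists_norm_eq_zpow {K A : Type*} [NormedField K] [IsUltrametricDist K] [CommRing A]
    [IsDomain A] [IsDiscreteValuationRing A] [Algebra A K]
    (hA : (valuation (K := K)).Integers A) {ϖ : A} (hϖ : Irreducible ϖ) {x : K} (hx : x ≠ 0) :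
    ∃ n : ℤ, ‖x‖ = ‖algebraMap A K ϖ‖ ^ n := by
  have key : ∀ a : A, a ≠ 0 → ∃ n : ℕ, ‖algebraMap A K a‖ = ‖algebraMap A K ϖ‖ ^ n := by
    intro a ha
    obtain ⟨n, u, rfl⟩ := IsDiscreteValuationRing.eq_unit_mul_pow_irreducible ha hϖ
    refine ⟨n, ?_⟩
    have hu : ‖algebraMap A K u‖ = 1 := congrArg NNReal.toReal (hA.valuation_unit u)
    rw [map_mul, norm_mul, hu, one_mul, map_pow, norm_pow]
  obtain ⟨a, ha | ha⟩ := hA.eq_algebraMap_or_inv_eq_algebraMap x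
  · obtain ⟨n, hn⟩ := key a (by rintro rfl; simp [hx] at ha)
    exact ⟨n, by rw [ha, hn, zpow_natCast]⟩
  · obtain ⟨n, hn⟩ := key a (by rintro rfl; simp [hx] at ha)
    refine ⟨-n, ?_⟩
    rw [zpow_neg, zpow_natCast, ← hn, ← ha, norm_inv, inv_inv]

theorem Valuation.Integers.faithfulSMul_extension {A K Γ : Type*} [CommRing A] [Field K]
    [Algebra A K] [LinearOrderedCommGroupWithZero Γ] {v : Valuation K Γ} (hA : v.Integers A)
    (L : Type*) [Field L] [Algebra K L] [Algebra A L] [IsScalarTower A K L] : FaithfulSMul A L :=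
  (faithfulSMul_iff_algebraMap_injective A L).mpr <| by
    rw [IsScalarTower.algebraMap_eq A K L]
    exact (algebraMap K L).injective.comp hA.hom_inj

variable {A K L : Type*} [NontriviallyNormedField K] [IsUltrametricDist K] [CompleteSpace K]
  [NormedField L] [NormedAlgebra K L] [FiniteDimensional K L]
  [CommRing A] [Algebra A K] [Algebra A L] [IsScalarTower A K L]

/-- The spectral norm is at most 1 exactly when all coefficients of the minimal polynomial are, that
is, when they lie in the integrally closed ring `A`. -/
theorem isIntegral_iff_norm_le_one (hA : (valuation (K := K)).Integers A) (x : L) :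
    IsIntegral A x ↔ ‖x‖ ≤ 1 := by
  have : IsDomain A := hA.hom_inj.isDomain
  have : IsFractionRing A K := hA.isFractionRing
  have : ValuationRing A := .of_integers valuation hA
  have hm := minpoly.monic (Algebra.IsIntegral.isIntegral (R := K) x)
  rw [NormedAlgebra.norm_eq_spectralNorm K x, spectralNorm, spectralValue_le_one_iff hm]
  refine ⟨fun h i ↦ ?_, fun h ↦ ?_⟩
  · rw [minpoly.isIntegrallyClosed_eq_field_fractions' K h, coeff_map]
    exact hA.map_le_one _
  · have hlift : minpoly K x ∈ lifts (algebraMap A K) :=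
      (lifts_iff_coeff_lifts _).mpr fun i ↦ hA.exists_of_le_one (h i)
    obtain ⟨g, hg, -, hgm⟩ := lifts_and_natDegree_eq_and_monic hlift hm
    refine ⟨g, hgm, ?_⟩
    rw [← aeval_def, ← aeval_map_algebraMap K, hg, minpoly.aeval]

variable [IsUltrametricDist L]

theorem integers_integralClosure (hA : (valuation (K := K)).Integers A) :
    (valuation (K := L)).Integers (integralClosure A L) where
  hom_inj := Subtype.val_injective
  map_le_one x := (isIntegral_iff_norm_le_one hA (x : L)).mp x.2
  exists_of_le_one r hr := ⟨⟨r, (isIntegral_iff_norm_le_one hA r).mpr hr⟩, rfl⟩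

theorem isLocalRing_integralClosure (hA : (valuation (K := K)).Integers A) :
    IsLocalRing (integralClosure A L) :=
  have : ValuationRing (integralClosure A L) := .of_integers _ (integers_integralClosure hA)
  inferInstance

variable [IsDomain A] [IsDiscreteValuationRing A] [Algebra.IsSeparable K L]

theorem isDiscreteValuationRing_integralClosure (hA : (valuation (K := K)).Integers A) :
    IsDiscreteValuationRing (integralClosure A L) := by
  have : IsFractionRing A K := hA.isFractionRing
  have := isLocalRing_integralClosure (L := L) hA
  have : IsDedekindDomain (integralClosure A L) := IsIntegralClosure.isDedekindDomain A K L _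
  have := hA.faithfulSMul_extension L
  refine ((IsDiscreteValuationRing.TFAE (integralClosure A L) fun h ↦ ?_).out 2 0).mp ‹_›
  exact IsDiscreteValuationRing.not_isField A (isField_of_isIntegral_of_isField
    (FaithfulSMul.algebraMap_injective A (integralClosure A L)) h)

theorem irreducible_algebraMap_of_formallyUnramified (hA : (valuation (K := K)).Integers A)
    [Algebra.FormallyUnramified A (integralClosure A L)] {ϖ : A} (hϖ : Irreducible ϖ) :
    Irreducible (algebraMap A (integralClosure A L) ϖ) := by
  have : IsFractionRing A K := hA.isFractionRing
  have := isDiscreteValuationRing_integralClosure (L := L) hA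
  have : Module.Finite A (integralClosure A L) := IsIntegralClosure.finite A K L _
  have := hA.faithfulSMul_extension L
  have h := Algebra.FormallyUnramified.map_maximalIdeal (R := A) (S := integralClosure A L)
  rw [hϖ.maximalIdeal_eq, Ideal.map_span, Set.image_singleton] at h
  exact (IsDiscreteValuationRing.irreducible_iff_uniformizer _).mpr h.symm

end Integers

theorem natDegree_minpoly_eq_of_finrank_prime {K L : Type*} [Field K] [Field L] [Algebra K L]
    [FiniteDimensional K L] (hq : (Module.finrank K L).Prime) {x : L}
    (hx : x ∉ Set.range (algebraMap K L)) : (minpoly K x).natDegree = Module.finrank K L := by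
  have hint := Algebra.IsIntegral.isIntegral (R := K) x
  refine ((Nat.dvd_prime hq).mp (minpoly.degree_dvd hint)).resolve_left fun h ↦ hx ?_
  exact minpoly.natDegree_eq_one_iff.mp h

/-- Behaviour of the derivative of the minimal polynomial under scaling. -/
theorem mul_aeval_derivative_minpoly_smul {K L : Type*} [Field K] [Field L] [Algebra K L]
    {x : L} {c : K} (hx : IsIntegral K x)
    (hdeg : (minpoly K (c • x)).natDegree = (minpoly K x).natDegree) (hc : c ≠ 0) :
    algebraMap K L c * aeval (c • x) (minpoly K (c • x)).derivative =
      algebraMap K L c ^ (minpoly K x).natDegree * aeval x (minpoly K x).derivative := by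
  set H := minpoly K (c • x)
  set P := H.comp (C c * X) with hP
  have hH : H.Monic := minpoly.monic (hx.smul c)
  have hdegP : P.natDegree = (minpoly K x).natDegree := by
    rw [hP, natDegree_comp, natDegree_C_mul_X c hc, mul_one, hdeg]
  have hlead : P.leadingCoeff = c ^ (minpoly K x).natDegree := by
    rw [hP, leadingCoeff_comp (by rw [natDegree_C_mul_X c hc]; exact one_ne_zero), hH.leadingCoeff,
      one_mul, leadingCoeff_C_mul_X, hdeg]
  have hdvd : minpoly K x ∣ P := minpoly.dvd K x <| by
    rw [hP, aeval_comp, map_mul, aeval_C, aeval_X, ← Algebra.smul_def, minpoly.aeval]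
  have key := eq_leadingCoeff_mul_of_monic_of_dvd_of_natDegree_le (minpoly.monic hx) hdvd hdegP.le
  have hder := congrArg (fun Q ↦ aeval x (derivative Q)) key
  rw [hlead] at hder
  simpa [hP, derivative_comp, aeval_comp, ← Algebra.smul_def] using hder

/-! ### The derivative of the minimal polynomial: ramified and unramified cases. -/

section Valued

open NormedField IsLocalRing

variable {A K L : Type*} [NontriviallyNormedField K] [IsUltrametricDist K] [CompleteSpace K]
  [NormedField L] [NormedAlgebra K L] [FiniteDimensional K L] [IsUltrametricDist L]
  [CommRing A] [Algebra A K] [IsDomain A] [IsDiscreteValuationRing A]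

/-- If the norm of a generator is not a norm from the base field, then the leading term dominates
in the derivative of the minimal polynomial. -/
theorem norm_aeval_derivative_minpoly_of_norm_ne_zpow (hA : (valuation (K := K)).Integers A)
    {ϖ : A} (hϖ : Irreducible ϖ) (hq : (Module.finrank K L).Prime)
    (hq1 : ‖(Module.finrank K L : K)‖ = 1) {x : L} (hx : x ∉ Set.range (algebraMap K L))
    (hr : ∀ m : ℤ, ‖x‖ ≠ ‖algebraMap A K ϖ‖ ^ m) :
    ‖aeval x (minpoly K x).derivative‖ = ‖x‖ ^ (Module.finrank K L - 1) := by
  set q := Module.finrank K L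
  have hx0 : x ≠ 0 := by rintro rfl; exact hx ⟨0, map_zero _⟩
  have hrpos : 0 < ‖x‖ := norm_pos_iff.mpr hx0
  have hdeg : (minpoly K x).natDegree = q := natDegree_minpoly_eq_of_finrank_prime hq hx
  have hint := Algebra.IsIntegral.isIntegral (R := K) x
  have hq0 : 0 < q := hq.pos
  have hϖ0 : ‖algebraMap A K ϖ‖ ≠ 0 := by
    rw [norm_ne_zero_iff, Ne, map_eq_zero_iff _ hA.hom_inj]
    exact hϖ.ne_zero
  obtain ⟨N, hN⟩ := exists_norm_eq_zpow hA hϖ (minpoly.coeff_zero_ne_zero hint hx0)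
  rw [norm_coeff_zero_minpoly, hdeg] at hN
  have hlt : ∀ i ∈ Finset.range (q - 1),
      ‖(minpoly K x).derivative.coeff i • x ^ i‖ < ‖x‖ ^ (q - 1) := by
    intro i hi
    rw [Finset.mem_range] at hi
    have hpow : ‖x‖ ^ (q - 1) = ‖x‖ ^ (q - (i + 1)) * ‖x‖ ^ i := by
      rw [← pow_add]; congr 1; omega
    rw [norm_smul, norm_pow, hpow]
    refine mul_lt_mul_of_pos_right (lt_of_le_of_ne ?_ fun h ↦ ?_) (pow_pos hrpos i)
    · rw [coeff_derivative, norm_mul]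
      have h1 := norm_coeff_minpoly_le (K := K) x (i := i + 1) (by omega)
      rw [hdeg] at h1
      refine (mul_le_of_le_one_right (norm_nonneg _) ?_).trans h1
      exact_mod_cast IsUltrametricDist.norm_natCast_le_one K (i + 1)
    · have hne : (minpoly K x).derivative.coeff i ≠ 0 := by
        rw [← norm_ne_zero_iff, h]
        exact (pow_pos hrpos _).ne'
      obtain ⟨n, hn⟩ := exists_norm_eq_zpow hA hϖ hne
      rw [h] at hn
      -- Equality would make `‖x‖^(q-(i+1))` a norm from `K`, as `‖x‖^q` already is; since `0 <
      -- q-(i+1) < q`, Bézout would make `‖x‖` one too.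
      have hcop : IsCoprime ((q - (i + 1) : ℕ) : ℤ) (q : ℤ) :=
        Nat.isCoprime_iff_coprime.mpr
          ((hq.coprime_iff_not_dvd.mpr fun h ↦ by
            have := Nat.le_of_dvd (by omega) h
            omega).symm)
      obtain ⟨a, b, hab⟩ := hcop
      apply hr (a * n + b * N) |>.elim
      rw [zpow_add₀ hϖ0, mul_comm a, mul_comm b, zpow_mul, zpow_mul, ← hn, ← hN,
        ← zpow_natCast, ← zpow_natCast, ← zpow_mul, ← zpow_mul, ← zpow_add₀ hrpos.ne',
        mul_comm _ a, mul_comm _ b, hab, zpow_one]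
  have htop : ‖(minpoly K x).derivative.coeff (q - 1) • x ^ (q - 1)‖ = ‖x‖ ^ (q - 1) := by
    have hc : ((q - 1 : ℕ) : K) + 1 = q := by
      rw [← Nat.cast_add_one, Nat.sub_add_cancel hq0]
    rw [norm_smul, norm_pow, coeff_derivative, hc, norm_mul, hq1, Nat.sub_add_cancel hq0, ← hdeg,
      (minpoly.monic hint).coeff_natDegree, norm_one, one_mul, one_mul]
  have hlow : ‖∑ i ∈ Finset.range (q - 1), (minpoly K x).derivative.coeff i • x ^ i‖ <
      ‖x‖ ^ (q - 1) := by
    rcases (Finset.range (q - 1)).eq_empty_or_nonempty with h | h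
    · rw [h, Finset.sum_empty, norm_zero]
      exact pow_pos hrpos _
    · obtain ⟨i, hi, hle⟩ := IsUltrametricDist.exists_norm_finsetSum_le_of_nonempty h
        fun i ↦ (minpoly K x).derivative.coeff i • x ^ i
      exact hle.trans_lt (hlt i hi)
  have hnat : (minpoly K x).derivative.natDegree < q - 1 + 1 := by
    have := natDegree_derivative_le (minpoly K x)
    omega
  rw [aeval_eq_sum_range' hnat, Finset.sum_range_succ,
    IsUltrametricDist.norm_add_eq_max_of_norm_ne_norm (by rw [htop]; exact hlow.ne), htop,
    max_eq_right hlow.le]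

variable [Algebra A L] [IsScalarTower A K L] [Algebra.IsSeparable K L]

theorem exists_norm_eq_zpow_of_formallyUnramified (hA : (valuation (K := K)).Integers A)
    [Algebra.FormallyUnramified A (integralClosure A L)] {ϖ : A} (hϖ : Irreducible ϖ) {x : L}
    (hx : x ≠ 0) : ∃ n : ℤ, ‖x‖ = ‖algebraMap A K ϖ‖ ^ n := by
  have := isDiscreteValuationRing_integralClosure (L := L) hA
  obtain ⟨n, hn⟩ := exists_norm_eq_zpow (integers_integralClosure (L := L) hA)
    (irreducible_algebraMap_of_formallyUnramified hA hϖ) hx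
  refine ⟨n, ?_⟩
  rw [hn, ← IsScalarTower.algebraMap_apply, IsScalarTower.algebraMap_apply A K L,
    norm_algebraMap']

variable [PerfectField (ResidueField A)]

/-- If the norm of a trace-zero generator is a norm from the base field, then the extension is
unramified and the derivative of the minimal polynomial has the generic norm. -/
theorem formallyUnramified_and_norm_aeval_derivative_minpoly
    (hA : (valuation (K := K)).Integers A) {ϖ : A} (hϖ : Irreducible ϖ)
    (hq : (Module.finrank K L).Prime) (hq1 : ‖(Module.finrank K L : K)‖ = 1) {x : L}
    (hx : x ∉ Set.range (algebraMap K L)) (htr : Algebra.trace K L x = 0) {m : ℤ}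
    (hm : ‖x‖ = ‖algebraMap A K ϖ‖ ^ m) :
    Algebra.FormallyUnramified A (integralClosure A L) ∧
      ‖aeval x (minpoly K x).derivative‖ = ‖x‖ ^ (Module.finrank K L - 1) := by
  set B := integralClosure A L
  have hB : (valuation (K := L)).Integers B := integers_integralClosure hA
  have : IsFractionRing A K := hA.isFractionRing
  have := isDiscreteValuationRing_integralClosure (L := L) hA
  have := hA.faithfulSMul_extension L
  have : Module.Finite A B := IsIntegralClosure.finite A K L _
  have : Module.Free A B := IsIntegralClosure.module_free A K L _
  have hrank : Module.finrank A B = Module.finrank K L :=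
    IsIntegralClosure.rank A K L B
  have hϖ0 : algebraMap A K ϖ ≠ 0 := by
    rw [Ne, map_eq_zero_iff _ hA.hom_inj]
    exact hϖ.ne_zero
  set c : K := algebraMap A K ϖ ^ m with hc
  have hc0 : c ≠ 0 := zpow_ne_zero _ hϖ0
  have hcn : ‖c‖ = ‖x‖ := by rw [hc, norm_zpow, hm]
  have hx0 : 0 < ‖x‖ := hcn ▸ norm_pos_iff.mpr hc0
  set y : L := c⁻¹ • x with hy
  have hcy : x = c • y := by rw [hy, smul_inv_smul₀ hc0]
  have hynorm : ‖y‖ = 1 := by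
    rw [hy, norm_smul, norm_inv, hcn, inv_mul_cancel₀ hx0.ne']
  obtain ⟨u, hu⟩ := hB.exists_of_le_one (r := y) (le_of_eq (NNReal.eq hynorm))
  have hyK : y ∉ Set.range (algebraMap K L) := by
    rintro ⟨d, hd⟩
    exact hx ⟨c * d, by rw [hcy, map_mul, hd, Algebra.smul_def]⟩
  -- A residue coming from `a : A` would put `x` at distance less than `‖x‖` from `c * a`, whereas
  -- trace zero makes 0 a closest point of `K` to `x`.
  have hres : residue B u ∉ Set.range (algebraMap (ResidueField A) (ResidueField B)) := by
    rintro ⟨a, ha⟩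
    obtain ⟨a, rfl⟩ := residue_surjective a
    have hmem : u - algebraMap A B a ∈ maximalIdeal B := by
      rw [← residue_eq_zero_iff, map_sub, ← ha, sub_eq_zero]
      rfl
    have hlt : ‖y - algebraMap A L a‖ < 1 := by
      rw [mem_maximalIdeal, mem_nonunits_iff, hB.isUnit_iff_valuation_eq_one, map_sub, hu,
        ← IsScalarTower.algebraMap_apply] at hmem
      refine lt_of_le_of_ne ?_ fun h ↦ hmem (NNReal.eq h)
      have := hB.map_le_one (u - algebraMap A B a)
      rwa [map_sub, hu, ← IsScalarTower.algebraMap_apply] at this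
    have hle := norm_le_norm_sub_of_trace_eq_zero hq1 htr (c * algebraMap A K a)
    have hfac : x - algebraMap K L (c * algebraMap A K a) = c • (y - algebraMap A L a) := by
      rw [smul_sub, ← hcy, map_mul, ← IsScalarTower.algebraMap_apply, Algebra.smul_def]
    have hmax : ‖x‖ ≤ ‖x - algebraMap K L (c * algebraMap A K a)‖ := by
      have := IsUltrametricDist.norm_add_le_max (x - algebraMap K L (c * algebraMap A K a))
        (algebraMap K L (c * algebraMap A K a))
      rwa [sub_add_cancel, norm_algebraMap', max_eq_left hle] at this
    rw [hfac, norm_smul, hcn] at hmax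
    exact absurd (mul_lt_of_lt_one_right hx0 hlt) hmax.not_gt
  have hunr : Algebra.FormallyUnramified A B :=
    formallyUnramified_of_residue_notMem_range (hrank ▸ hq) hres
  refine ⟨hunr, ?_⟩
  have hunit := isUnit_aeval_derivative_minpoly_of_residue_notMem_range (hrank ▸ hq) hres
  have hnorm : ‖aeval y (minpoly K y).derivative‖ = 1 := by
    have h := congrArg NNReal.toReal (hB.one_of_isUnit hunit)
    have hmin : minpoly K y = (minpoly A u).map (algebraMap A K) := by
      rw [← hu, ← minpoly.isIntegrallyClosed_eq_field_fractions K L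
        (IsIntegralClosure.isIntegral A L u)]
    rw [hmin, derivative_map, aeval_map_algebraMap, ← hu, aeval_algebraMap_apply]
    exact h
  have hdy := natDegree_minpoly_eq_of_finrank_prime hq hyK
  have hscale := congrArg norm (mul_aeval_derivative_minpoly_smul (c := c)
    (Algebra.IsIntegral.isIntegral (R := K) y)
    (by rw [hdy, ← hcy]; exact natDegree_minpoly_eq_of_finrank_prime hq hx) hc0)
  rw [← hcy, hdy, norm_mul, norm_mul, norm_pow, norm_algebraMap', hnorm, hcn, mul_one] at hscale
  apply mul_left_cancel₀ hx0.ne'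
  rw [hscale, ← pow_succ', Nat.sub_add_cancel hq.pos]

end Valued

/-! ### Primitive polynomials, the trace-zero part, and the discriminant formula. -/

theorem Polynomial.discr_map_of_injective {R S : Type*} [CommRing R] [CommRing S] [IsDomain S]
    {φ : R →+* S} (hφ : Function.Injective φ) {f : R[X]} (hf : 0 < f.natDegree) :
    (f.map φ).discr = φ f.discr := by
  have hdeg : (f.map φ).natDegree = f.natDegree := natDegree_map_eq_of_injective hφ f
  have hlc : (f.map φ).leadingCoeff ≠ 0 := by
    rw [leadingCoeff_ne_zero, Polynomial.map_ne_zero_iff hφ]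
    rintro rfl
    simp at hf
  have h := resultant_deriv (natDegree_pos_iff_degree_pos.mp (hdeg ▸ hf : 0 < (f.map φ).natDegree))
  rw [hdeg, derivative_map, resultant_map_map, resultant_deriv (natDegree_pos_iff_degree_pos.mp hf),
    leadingCoeff_map_of_injective hφ, map_mul, map_mul, map_pow, map_neg, map_one] at h
  rw [leadingCoeff_map_of_injective hφ] at hlc
  exact (mul_left_cancel₀ (mul_ne_zero (pow_ne_zero _ (neg_ne_zero.mpr one_ne_zero)) hlc) h).symm

theorem Polynomial.IsPrimitive.exists_isUnit_coeff {A : Type*} [CommRing A] [IsDomain A]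
    [IsDiscreteValuationRing A] {f : A[X]} (hf : f.IsPrimitive) : ∃ i, IsUnit (f.coeff i) := by
  by_contra! h
  obtain ⟨ϖ, hϖ⟩ := IsDiscreteValuationRing.exists_irreducible A
  refine hϖ.not_isUnit (hf ϖ (C_dvd_iff_dvd_coeff ϖ f |>.mpr fun i ↦ ?_))
  rw [← Ideal.mem_span_singleton, ← hϖ.maximalIdeal_eq]
  exact h i

section Valued

open NormedField IsLocalRing

variable {A K L : Type*} [NontriviallyNormedField K] [IsUltrametricDist K] [CompleteSpace K]
  [NormedField L] [NormedAlgebra K L] [FiniteDimensional K L]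
  [CommRing A] [Algebra A K] [IsDomain A] [IsDiscreteValuationRing A]

/-- The leading coefficient of a primitive polynomial in terms of the norm of its roots. -/
theorem norm_leadingCoeff_mul_max_pow (hA : (valuation (K := K)).Integers A) {f : A[X]}
    (hf : f.IsPrimitive) {θ : L}
    (hθ : f.map (algebraMap A K) = C (algebraMap A K f.leadingCoeff) * minpoly K θ)
    (hdeg : (minpoly K θ).natDegree = f.natDegree) :
    ‖algebraMap A K f.leadingCoeff‖ * max 1 ‖θ‖ ^ f.natDegree = 1 := by
  have hcoeff : ∀ i, algebraMap A K (f.coeff i) =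
      algebraMap A K f.leadingCoeff * (minpoly K θ).coeff i := fun i ↦ by
    rw [← coeff_map, hθ, coeff_C_mul]
  apply le_antisymm
  · rcases le_total ‖θ‖ 1 with h | h
    · rw [max_eq_left h, one_pow, mul_one]
      exact hA.map_le_one _
    -- Here the left side is the norm of the constant coefficient of `f`.
    · rw [max_eq_right h, ← hdeg, ← norm_coeff_zero_minpoly (K := K), ← norm_mul, ← hcoeff]
      exact hA.map_le_one _
  -- A unit coefficient, bounded by the leading coefficient times a power of `‖θ‖`, gives the
  -- reverse inequality.
  · obtain ⟨i, hi⟩ := hf.exists_isUnit_coeff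
    have hi1 : ‖algebraMap A K (f.coeff i)‖ = 1 := congrArg NNReal.toReal (hA.one_of_isUnit hi)
    have hin : i ≤ (minpoly K θ).natDegree := hdeg ▸ le_natDegree_of_ne_zero hi.ne_zero
    rw [hcoeff, norm_mul] at hi1
    refine hi1.ge.trans ?_
    rw [← hdeg]
    refine mul_le_mul_of_nonneg_left ((norm_coeff_minpoly_le θ hin).trans ?_) (norm_nonneg _)
    exact (pow_le_pow_left₀ (norm_nonneg _) (le_max_right 1 _) _).trans
      (pow_le_pow_right₀ (le_max_left _ _) (Nat.sub_le _ _))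

/-- The representative of `θ + K` of trace zero. -/
noncomputable def traceZeroPart (K : Type*) {L : Type*} [Field K] [Field L] [Algebra K L] (θ : L) :
    L :=
  θ - algebraMap K L (Algebra.trace K L θ / Module.finrank K L)

theorem traceZeroPart_notMem_range {K L : Type*} [Field K] [Field L] [Algebra K L] {θ : L}
    (hθ : θ ∉ Set.range (algebraMap K L)) : traceZeroPart K θ ∉ Set.range (algebraMap K L) := by
  rintro ⟨d, hd⟩
  exact hθ ⟨d + Algebra.trace K L θ / Module.finrank K L, by
    rw [map_add, hd, traceZeroPart, sub_add_cancel]⟩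

theorem trace_traceZeroPart {K L : Type*} [Field K] [Field L] [Algebra K L]
    (h : (Module.finrank K L : K) ≠ 0) (θ : L) : Algebra.trace K L (traceZeroPart K θ) = 0 := by
  rw [traceZeroPart, map_sub, Algebra.trace_algebraMap, nsmul_eq_mul, mul_div_cancel₀ _ h, sub_self]

theorem aeval_derivative_minpoly_traceZeroPart {K L : Type*} [Field K] [Field L] [Algebra K L]
    (θ : L) : aeval (traceZeroPart K θ) (minpoly K (traceZeroPart K θ)).derivative =
      aeval θ (minpoly K θ).derivative := by
  rw [traceZeroPart, minpoly.sub_algebraMap, derivative_comp]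
  simp [aeval_comp]

variable [IsUltrametricDist L] [Algebra A L] [IsScalarTower A K L] [Algebra.IsSeparable K L]
  [PerfectField (ResidueField A)]

theorem norm_aeval_derivative_minpoly_of_finrank_prime (hA : (valuation (K := K)).Integers A)
    (hq : (Module.finrank K L).Prime) (hq1 : ‖(Module.finrank K L : K)‖ = 1)
    {θ : L} (hθ : θ ∉ Set.range (algebraMap K L)) :
    ‖aeval θ (minpoly K θ).derivative‖ = ‖traceZeroPart K θ‖ ^ (Module.finrank K L - 1) := by
  obtain ⟨ϖ, hϖ⟩ := IsDiscreteValuationRing.exists_irreducible A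
  have hq0 : (Module.finrank K L : K) ≠ 0 := norm_ne_zero_iff.mp (hq1 ▸ one_ne_zero)
  rw [← aeval_derivative_minpoly_traceZeroPart]
  by_cases hm : ∃ m : ℤ, ‖traceZeroPart K θ‖ = ‖algebraMap A K ϖ‖ ^ m
  · obtain ⟨m, hm⟩ := hm
    exact (formallyUnramified_and_norm_aeval_derivative_minpoly hA hϖ hq hq1
      (traceZeroPart_notMem_range hθ) (trace_traceZeroPart hq0 θ) hm).2
  · exact norm_aeval_derivative_minpoly_of_norm_ne_zpow hA hϖ hq hq1
      (traceZeroPart_notMem_range hθ) (not_exists.mp hm)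

theorem norm_discr_of_finrank_prime (hA : (valuation (K := K)).Integers A)
    (hq : (Module.finrank K L).Prime) (hq1 : ‖(Module.finrank K L : K)‖ = 1)
    {f : A[X]} (hf : f.IsPrimitive) (hdeg : f.natDegree = Module.finrank K L)
    {θ : L} (hθK : θ ∉ Set.range (algebraMap K L)) (hθ : aeval θ f = 0) :
    ‖algebraMap A K f.discr‖ = (‖traceZeroPart K θ‖ / max 1 ‖θ‖ ^ 2) ^
      (Module.finrank K L * (Module.finrank K L - 1)) := by
  have hθdeg := natDegree_minpoly_eq_of_finrank_prime hq hθK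
  have hFdeg : (f.map (algebraMap A K)).natDegree = f.natDegree :=
    natDegree_map_eq_of_injective hA.hom_inj f
  have hlead := leadingCoeff_map_of_injective hA.hom_inj f
  have hF := eq_leadingCoeff_mul_of_monic_of_dvd_of_natDegree_le
    (minpoly.monic (Algebra.IsIntegral.isIntegral (R := K) θ))
    (minpoly.dvd K θ (by rw [aeval_map_algebraMap, hθ]) :
      minpoly K θ ∣ f.map (algebraMap A K)) (by rw [hFdeg, hθdeg, hdeg])
  have hpos : 0 < f.natDegree := hdeg ▸ hq.pos
  have hF0 : f.map (algebraMap A K) ≠ 0 := by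
    intro h
    rw [h, natDegree_zero] at hFdeg
    omega
  have hlc := norm_leadingCoeff_mul_max_pow hA hf (by rwa [hlead] at hF) (hθdeg.trans hdeg.symm)
  have hM : 0 < max 1 ‖θ‖ := lt_max_of_lt_left one_pos
  rw [← discr_map_of_injective hA.hom_inj hpos, norm_discr_eq hF hF0, hFdeg, hlead,
    norm_aeval_derivative_minpoly_of_finrank_prime hA hq hq1 hθK, ← hdeg,
    eq_inv_of_mul_eq_one_left hlc, div_pow, div_eq_mul_inv, ← inv_pow, ← inv_pow, ← inv_pow,
    ← pow_mul, ← pow_mul, ← pow_mul]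
  ring_nf

/-- An unramified extension has no new norms, which gives one direction. Conversely it suffices to
show that `‖traceZeroPart K θ‖` is a norm from `K`; the denominator only matters when `‖θ‖ > 1`. -/
theorem formallyUnramified_iff_exists_zpow (hA : (valuation (K := K)).Integers A) {ϖ : A}
    (hϖ : Irreducible ϖ) (hq : (Module.finrank K L).Prime)
    (hq1 : ‖(Module.finrank K L : K)‖ = 1) {θ : L} (hθ : θ ∉ Set.range (algebraMap K L)) :
    Algebra.FormallyUnramified A (integralClosure A L) ↔
      ∃ k : ℤ, ‖traceZeroPart K θ‖ / max 1 ‖θ‖ ^ 2 = ‖algebraMap A K ϖ‖ ^ k := by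
  have hq0 : (Module.finrank K L : K) ≠ 0 := norm_ne_zero_iff.mp (hq1 ▸ one_ne_zero)
  have hα := traceZeroPart_notMem_range hθ
  have htr := trace_traceZeroPart hq0 θ
  have hα0 : traceZeroPart K θ ≠ 0 := fun h ↦ hα ⟨0, by rw [map_zero, h]⟩
  have hθ0 : θ ≠ 0 := fun h ↦ hθ ⟨0, by rw [map_zero, h]⟩
  have hϖ0 : ‖algebraMap A K ϖ‖ ≠ 0 := by
    rw [norm_ne_zero_iff, Ne, map_eq_zero_iff _ hA.hom_inj]
    exact hϖ.ne_zero
  have hback : ∀ m : ℤ, ‖traceZeroPart K θ‖ = ‖algebraMap A K ϖ‖ ^ m →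
      Algebra.FormallyUnramified A (integralClosure A L) := fun m hm ↦
    (formallyUnramified_and_norm_aeval_derivative_minpoly hA hϖ hq hq1 hα htr hm).1
  constructor
  · intro h
    obtain ⟨a, ha⟩ := exists_norm_eq_zpow_of_formallyUnramified hA hϖ hα0
    rcases le_total ‖θ‖ 1 with h1 | h1
    · exact ⟨a, by rw [max_eq_left h1, one_pow, div_one, ha]⟩
    · obtain ⟨b, hb⟩ := exists_norm_eq_zpow_of_formallyUnramified hA hϖ hθ0
      refine ⟨a - b * 2, ?_⟩
      rw [max_eq_right h1, ha, hb, zpow_sub₀ hϖ0, zpow_mul]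
      norm_cast
  · rintro ⟨k, hk⟩
    rcases le_total ‖θ‖ 1 with h1 | h1
    · rw [max_eq_left h1, one_pow, div_one] at hk
      exact hback k hk
    · rw [max_eq_right h1, div_eq_iff (pow_ne_zero _ (norm_ne_zero_iff.mpr hθ0))] at hk
      have hθn : ∃ b : ℤ, ‖θ‖ = ‖algebraMap A K ϖ‖ ^ b := by
        -- If `‖θ‖` is not a norm from `K`, the trace term is strictly smaller than `θ`, so the
        -- ratio is `‖θ‖⁻¹`, contradicting `hk`.
        by_contra hb
        set c : K := Algebra.trace K L θ / Module.finrank K L with hc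
        have hcle : ‖c‖ ≤ ‖θ‖ := by
          rw [hc, norm_div, hq1, div_one]
          exact norm_trace_le θ
        have hclt : ‖c‖ < ‖θ‖ := by
          refine lt_of_le_of_ne hcle fun h ↦ hb ?_
          rw [← h]
          refine exists_norm_eq_zpow hA hϖ fun h0 ↦ hθ0 ?_
          rwa [h0, norm_zero, eq_comm, norm_eq_zero] at h
        have hαθ : ‖traceZeroPart K θ‖ = ‖θ‖ := by
          rw [traceZeroPart, ← hc, sub_eq_add_neg, IsUltrametricDist.norm_add_eq_max_of_norm_ne_norm]
          · rw [norm_neg, norm_algebraMap', max_eq_left hcle]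
          · rw [norm_neg, norm_algebraMap']
            exact hclt.ne'
        rw [hαθ, pow_two, ← mul_assoc, eq_comm, mul_eq_right₀ (norm_ne_zero_iff.mpr hθ0)] at hk
        exact hb ⟨-k, by rw [zpow_neg]; exact eq_inv_of_mul_eq_one_right hk⟩
      obtain ⟨b, hb⟩ := hθn
      refine hback (k + b * 2) ?_
      rw [hk, hb, zpow_add₀ hϖ0, zpow_mul]
      norm_cast

end Valued

theorem isUnramifiedExtension_iff_formallyUnramified {A L : Type*} (K : Type*) [CommRing A]
    [IsDomain A] [IsIntegrallyClosed A] [IsNoetherianRing A] [Field K] [Algebra A K]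
    [IsFractionRing A K] [Field L] [Algebra A L] [Algebra K L] [IsScalarTower A K L]
    [FiniteDimensional K L] [Algebra.IsSeparable K L] :
    IsUnramifiedExtension A L ↔ Algebra.FormallyUnramified A (integralClosure A L) := by
  refine ⟨fun h ↦ h.formallyUnramified, fun h ↦ ⟨h, ?_⟩⟩
  have : Module.Finite A (integralClosure A L) := IsIntegralClosure.finite A K L _
  infer_instance

/-! ### Specialization to unramified extensions of the p-adic numbers. -/

section Padic

open NormedField IsLocalRing

theorem integers_padicInt (p : ℕ) [Fact p.Prime] :
    (valuation (K := ℚ_[p])).Integers ℤ_[p] where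
  hom_inj := Subtype.val_injective
  map_le_one x := x.2
  exists_of_le_one r hr := ⟨⟨r, hr⟩, rfl⟩

theorem perfectField_residueField_of_finite {R S : Type*} [CommRing R] [CommRing S] [Algebra R S]
    [IsLocalRing R] [IsLocalRing S] [Module.Finite R S] [FaithfulSMul R S]
    [PerfectField (ResidueField R)] : PerfectField (ResidueField S) :=
  Algebra.IsAlgebraic.perfectField (K := ResidueField R)

instance PadicInt.perfectField_residueField (p : ℕ) [Fact p.Prime] :
    PerfectField (ResidueField ℤ_[p]) :=
  have : Finite (ResidueField ℤ_[p]) := inferInstance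
  inferInstance

variable {p q : ℕ} [Fact p.Prime] {K L : Type*} [NontriviallyNormedField K] [IsUltrametricDist K]
  [CompleteSpace K] [NormedAlgebra ℚ_[p] K] [FiniteDimensional ℚ_[p] K]
  [Algebra ℤ_[p] K] [IsScalarTower ℤ_[p] ℚ_[p] K]

theorem isUnramifiedExtension_iff_exists_extPadicVal_discr_eq (hq : q.Prime) (hqp : q ≠ p)
    (hK : IsUnramifiedExtension ℤ_[p] K)
    (f : (integralClosure ℤ_[p] K)[X]) (hf : Irreducible f) (hdeg : f.natDegree = q)
    [NormedField L] [IsUltrametricDist L] [NormedAlgebra K L] [FiniteDimensional K L]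
    {θ : L} (hθ : aeval θ f = 0) (hL : K⟮θ⟯ = ⊤) :
    IsUnramifiedExtension (integralClosure ℤ_[p] K) L ↔
      ∃ k : ℤ, extPadicVal p K (f.discr : K) = k * ((q : ℝ) * ((q : ℝ) - 1)) := by
  have hZ := integers_padicInt p
  have hA : (valuation (K := K)).Integers (integralClosure ℤ_[p] K) := integers_integralClosure hZ
  have := isDiscreteValuationRing_integralClosure (L := K) hZ
  have := hZ.faithfulSMul_extension K
  have : Module.Finite ℤ_[p] (integralClosure ℤ_[p] K) := IsIntegralClosure.finite ℤ_[p] ℚ_[p] K _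
  have : PerfectField (ResidueField (integralClosure ℤ_[p] K)) :=
    perfectField_residueField_of_finite (R := ℤ_[p])
  have : IsFractionRing (integralClosure ℤ_[p] K) K := hA.isFractionRing
  have : CharZero K := charZero_of_injective_algebraMap (algebraMap ℚ_[p] K).injective
  have := hK.formallyUnramified
  -- Unramifiedness of `K` enters here: `p` stays a uniformizer, so the norms from `K` are the
  -- integral powers of `p`.
  have hϖ : Irreducible (algebraMap ℤ_[p] (integralClosure ℤ_[p] K) p) :=
    irreducible_algebraMap_of_formallyUnramified hZ PadicInt.irreducible_p
  have hϖn : ‖algebraMap (integralClosure ℤ_[p] K) K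
      (algebraMap ℤ_[p] (integralClosure ℤ_[p] K) p)‖ = (p : ℝ)⁻¹ := by
    rw [← IsScalarTower.algebraMap_apply, IsScalarTower.algebraMap_apply ℤ_[p] ℚ_[p] K,
      norm_algebraMap']
    simp
  have hqn : ‖(q : K)‖ = 1 := by
    rw [← map_natCast (algebraMap ℚ_[p] K), norm_algebraMap', Padic.norm_natCast_eq_one_iff]
    exact (Nat.coprime_primes Fact.out hq).mpr hqp.symm
  have hprim : f.IsPrimitive := hf.isPrimitive (by rw [hdeg]; exact hq.ne_zero)
  have hirr : Irreducible (f.map (algebraMap (integralClosure ℤ_[p] K) K)) :=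
    hprim.irreducible_iff_irreducible_map_fraction_map.mp hf
  have hFdeg : (f.map (algebraMap (integralClosure ℤ_[p] K) K)).natDegree = q :=
    (natDegree_map_eq_of_injective hA.hom_inj f).trans hdeg
  have hθint := Algebra.IsIntegral.isIntegral (R := K) θ
  have hmin : (minpoly K θ).natDegree = q := by
    have h := minpoly.eq_of_irreducible hirr (x := θ) (by rw [aeval_map_algebraMap, hθ])
    rw [← h, natDegree_mul_C (inv_ne_zero (leadingCoeff_ne_zero.mpr hirr.ne_zero)), hFdeg]
  have hrank : Module.finrank K L = q := by
    rw [← IntermediateField.finrank_top', ← hL, IntermediateField.adjoin.finrank hθint, hmin]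
  have hθK : θ ∉ Set.range (algebraMap K L) := by
    intro h
    rw [minpoly.natDegree_eq_one_iff.mpr h] at hmin
    exact hq.ne_one hmin.symm
  rw [isUnramifiedExtension_iff_formallyUnramified K,
    formallyUnramified_iff_exists_zpow hA hϖ (hrank ▸ hq) (hrank ▸ hqn) hθK, hϖn]
  have hdisc := norm_discr_of_finrank_prime hA (hrank ▸ hq) (hrank ▸ hqn) hprim
    (hdeg.trans hrank.symm) hθK hθ
  have hα0 : traceZeroPart K θ ≠ 0 := fun h ↦
    traceZeroPart_notMem_range hθK ⟨0, by rw [map_zero, h]⟩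
  -- Positivity makes the discriminant nonzero, so the junk value of the valuation at 0 never
  -- occurs.
  have hpos : 0 < ‖traceZeroPart K θ‖ / max 1 ‖θ‖ ^ 2 :=
    div_pos (norm_pos_iff.mpr hα0) (pow_pos (lt_max_of_lt_left one_pos) 2)
  have hp1 : (1 : ℝ) < p := by exact_mod_cast (Fact.out : p.Prime).one_lt
  have hqq : (q : ℝ) * ((q : ℝ) - 1) ≠ 0 := by
    have : (1 : ℝ) < q := by exact_mod_cast hq.one_lt
    nlinarith
  have hval : extPadicVal p K (f.discr : K) =
      -Real.logb p (‖traceZeroPart K θ‖ / max 1 ‖θ‖ ^ 2) * ((q : ℝ) * ((q : ℝ) - 1)) := by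
    rw [extPadicVal, ← NormedAlgebra.norm_eq_spectralNorm]
    change -Real.logb p ‖algebraMap (integralClosure ℤ_[p] K) K f.discr‖ = _
    rw [hdisc, Real.logb_pow, hrank, Nat.cast_mul, Nat.cast_sub hq.one_le, Nat.cast_one]
    ring
  rw [hval]
  refine exists_congr fun k ↦ ?_
  rw [mul_left_inj' hqq, neg_eq_iff_eq_neg, Real.logb_eq_iff_rpow_eq (by linarith) hp1.ne' hpos,
    Real.rpow_neg (by linarith), Real.rpow_intCast, inv_zpow, eq_comm]

end Padic

theorem mainTheorem7 (p q : ℕ) [Fact p.Prime] (hq : q.Prime) (hqp : q ≠ p)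
    (K : Type*) [Field K] [Algebra ℚ_[p] K] [FiniteDimensional ℚ_[p] K]
    [Algebra ℤ_[p] K] [IsScalarTower ℤ_[p] ℚ_[p] K]
    (hK : IsUnramifiedExtension ℤ_[p] K)
    (f : (integralClosure ℤ_[p] K)[X]) (hf : Irreducible f) (hdeg : f.natDegree = q)
    (L : Type*) [Field L] [Algebra K L] (θ : L) (hθ : aeval θ f = 0) :
    IsUnramifiedExtension (integralClosure ℤ_[p] K) K⟮θ⟯ ↔
      ∃ k : ℤ, extPadicVal p K (f.discr : K) = k * ((q : ℝ) * ((q : ℝ) - 1)) := by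
  have hθint : IsIntegral K θ := by
    refine isAlgebraic_iff_isIntegral.mp ⟨f.map (algebraMap _ K), ?_, ?_⟩
    · exact (Polynomial.map_ne_zero_iff Subtype.val_injective).mpr hf.ne_zero
    · rw [aeval_map_algebraMap, hθ]
  have : FiniteDimensional K K⟮θ⟯ := IntermediateField.adjoin.finiteDimensional hθint
  -- The bare fields receive their spectral norms, under which the base stays complete and both are
  -- ultrametric.
  let : NontriviallyNormedField K := spectralNorm.nontriviallyNormedField ℚ_[p] K
  let : NormedAlgebra ℚ_[p] K := spectralNorm.normedAlgebra ℚ_[p] K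
  have : IsUltrametricDist K :=
    IsUltrametricDist.isUltrametricDist_of_isNonarchimedean_norm isNonarchimedean_spectralNorm
  have : CompleteSpace K := FiniteDimensional.complete ℚ_[p] K
  let : NormedField K⟮θ⟯ := spectralNorm.normedField K K⟮θ⟯
  let : NormedAlgebra K K⟮θ⟯ := spectralNorm.normedAlgebra K K⟮θ⟯
  have : IsUltrametricDist K⟮θ⟯ :=
    IsUltrametricDist.isUltrametricDist_of_isNonarchimedean_norm isNonarchimedean_spectralNorm
  refine isUnramifiedExtension_iff_exists_extPadicVal_discr_eq hq hqp hK f hf hdeg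
    (θ := IntermediateField.AdjoinSimple.gen K θ) ?_ ?_
  · apply (algebraMap K⟮θ⟯ L).injective
    rw [← aeval_algebraMap_apply, IntermediateField.AdjoinSimple.algebraMap_gen, hθ, map_zero]
  · exact IntermediateField.adjoin_eq_top_of_algebra K _
      (IntermediateField.adjoin.powerBasis hθint).adjoin_gen_eq_top
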